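/- Let $R$ be a (commutative, unital) $f$-ring, i.e. a lattice-ordered ring with $(a\wedge b)c=ac\wedge bc$ for all $a,b\in R$ and all $c\ge 0$, and let $S=R^+=\{a\in R\mid a\ge 0\}$ be its positive cone, a commutative semiring; assume that $S$ is reduced, i.e. that $0$ is its only nilpotent element. Let $(L_S,\mathfrak{D})$ be a support of $S$: $L_S$ is a bounded distributive lattice and $\mathfrak{D}\colon S\to L_S$ is a map such that $L_S$ is generated as a bounded lattice by $\{\mathfrak{D}(s)\mid s\in S\}$ and, for all $a,b,b_1,\dots,b_n\in S$: $\mathfrak{D}(0)=0$ and $\mathfrak{D}(1)=1$; $\mathfrak{D}(a+b)\le\mathfrak{D}(a)\vee\mathfrak{D}(b)$; $\mathfrak{D}(ab)=\mathfrak{D}(a)\wedge\mathfrak{D}(b)$; and $\mathfrak{D}(a)\le\mathfrak{D}(b_1)\vee\cdots\vee\mathfrak{D}(b_n)$ implies that some power of $a$ lies in the ideal $\langle b_1,\dots,b_n\rangle$. Then the following are equivalent. 1. The set $\mathsf{Spec}(S)$ of all prime ideals of $S$, with the Zariski topology, is a Stone space (compact, Hausdorff and totally disconnected). 2. $L_S$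 is a Boolean algebra. 3. $S$ is a (von Neumann) regular semiring: for every $a\in S$ there is $b\in S$ with $a=a^2b$. 4. The frame $\mathsf{RId}(S)$ of radical ideals of $S$, ordered by inclusion, is zero-dimensional, i.e. each of its elements is a join of complemented elements. 5. Every prime ideal of $S$ is a maximal ideal. -/

import Mathlib

/-- An `f`-ring (commutative, with `1`): a lattice-ordered ring in which multiplication by
nonnegative elements distributes over binary meets. -/
class IsFRing (R : Type*) [CommRing R] [Lattice R] : Prop extends IsOrderedRing R where
  inf_mul_of_nonneg : ∀ a b c : R, 0 ≤ c → (a ⊓ b) * c = a * c ⊓ b * c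

/-- The positive cone of an ordered ring; for an ordered ring it carries Mathlib's
commutative semiring structure on the nonnegative elements. -/
abbrev PositiveCone (R : Type*) [CommRing R] [Lattice R] : Type _ := {x : R // 0 ≤ x}

/-- A support of a commutative semiring `S` on a bounded distributive lattice `L`. -/
structure IsSupport {S L : Type*} [CommSemiring S] [DistribLattice L] [BoundedOrder L]
    (D : S → L) : Prop where
  /-- `L` is generated, as a (bounded) lattice, by the elements `D s`:
  the only sublattice containing all of them is `L` itself;
  note that `⊥ = D 0` and `⊤ = D 1` are among the generators. -/
  generates : ∀ M : Sublattice L, (∀ s, D s ∈ M) → M = ⊤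
  map_zero : D 0 = ⊥
  map_one : D 1 = ⊤
  map_add_le : ∀ a b : S, D (a + b) ≤ D a ⊔ D b
  map_mul : ∀ a b : S, D (a * b) = D a ⊓ D b
  mem_radical : ∀ (a : S) (t : Finset S),
    D a ≤ t.sup D → a ∈ (Ideal.span (t : Set S)).radical

/-- The radical ideals of a commutative semiring, ordered by inclusion. -/
def RId (S : Type*) [CommSemiring S] : Type _ := {I : Ideal S // I.IsRadical}

namespace RId

variable {S : Type*} [CommSemiring S]

instance : PartialOrder (RId S) := inferInstanceAs (PartialOrder {I : Ideal S // I.IsRadical})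

/-- The radical of an ideal, as a radical ideal. -/
def ofIdeal (I : Ideal S) : RId S := ⟨I.radical, I.radical_isRadical⟩

/-- Taking radicals is left adjoint to the inclusion of radical ideals into all ideals. -/
def gi : GaloisInsertion (ofIdeal (S := S)) (fun I : RId S => I.1) where
  choice I hI := ⟨I, hI⟩
  gc _ J := J.2.radical_le_iff
  le_l_u _ := Ideal.le_radical
  choice_eq _ hI := Subtype.ext (le_antisymm Ideal.le_radical hI)

/-- Joins in `RId S` are radicals of sums of ideals, meets are intersections. -/
instance : CompleteLattice (RId S) := gi.liftCompleteLattice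

theorem coe_sup (I J : RId S) : (I ⊔ J).1 = (I.1 ⊔ J.1).radical := rfl

theorem coe_inf (I J : RId S) : (I ⊓ J).1 = I.1 ⊓ J.1 := rfl

theorem coe_sSup (A : Set (RId S)) :
    (sSup A).1 = (sSup ((fun I : RId S => I.1) '' A)).radical := rfl

theorem inf_sSup_le (I : RId S) (A : Set (RId S)) : I ⊓ sSup A ≤ ⨆ J ∈ A, I ⊓ J := by
  rintro x ⟨hxI, hxA⟩
  obtain ⟨n, hn⟩ : x ∈ (sSup ((fun I : RId S => I.1) '' A)).radical := hxA
  have key : I.1 * sSup ((fun I : RId S => I.1) '' A) ≤ (⨆ J ∈ A, I ⊓ J : RId S).1 := by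
    rw [sSup_image, Ideal.mul_iSup]
    refine iSup_le fun J => ?_
    rw [Ideal.mul_iSup]
    refine iSup_le fun hJ => ?_
    have h : I ⊓ J ≤ ⨆ J ∈ A, I ⊓ J := le_iSup₂_of_le J hJ le_rfl
    exact Ideal.mul_le_inf.trans h
  refine (⨆ J ∈ A, I ⊓ J : RId S).2 ⟨n + 1, key ?_⟩
  rw [pow_succ']
  exact Ideal.mul_mem_mul hxI hn

instance : Order.Frame (RId S) := Order.Frame.ofMinimalAxioms ⟨inf_sSup_le⟩

end RId

/-- A frame is zero-dimensional if every element is a join of complemented elements. -/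
def IsZeroDimensionalFrame (F : Type*) [Order.Frame F] : Prop :=
  ∀ x : F, ∃ C : Set F, (∀ c ∈ C, IsComplemented c) ∧ x = sSup C

/-- A Stone space: compact, Hausdorff and totally disconnected. -/
def IsStoneSpace (X : Type*) [TopologicalSpace X] : Prop :=
  CompactSpace X ∧ T2Space X ∧ TotallyDisconnectedSpace X

/-- A (von Neumann) regular commutative semiring. -/
def IsRegularSemiring (S : Type*) [CommSemiring S] : Prop :=
  ∀ a : S, ∃ b : S, a = a ^ 2 * b

/-! Regularity is the hub. If `a = a²b`, then `ab` is idempotent, and the `f`-ring axiom forces `ab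
≤ 1`; so `c = 1 - ab` lies in the positive cone, with `ac = 0` and `ab + c = 1`. This pair of
equations complements `a` simultaneously in the spectrum, the support and the frame of radical
ideals. Conversely, a complement of `D a`, or maximality of all primes, gives `1 = ax + z` with `az
= 0`; multiplying by `a` recovers regularity. -/

/-- Every principal ideal is complemented by a principal ideal annihilating its generator. -/
def HasPrincipalComplements (S : Type*) [CommSemiring S] : Prop :=
  ∀ a : S, ∃ b c : S, a * c = 0 ∧ a * b + c = 1

/-- In an `f`-ring every nonnegative idempotent is at most `1`. -/
theorem IsIdempotentElem.le_one_of_nonneg {R : Type*} [CommRing R] [Lattice R] [IsFRing R]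
    {e : R} (he : IsIdempotentElem e) (h0 : 0 ≤ e) : e ≤ 1 := by
  have he' : e * e = e := he
  have hf0 : 0 ≤ 1 ⊓ e := le_inf zero_le_one h0
  have hfe : (1 ⊓ e) * e = e := by
    rw [IsFRing.inf_mul_of_nonneg _ _ _ h0, one_mul, he', inf_idem]
  have hff : (1 ⊓ e) * (1 ⊓ e) = 1 ⊓ e := by
    conv_lhs => rw [IsFRing.inf_mul_of_nonneg 1 e _ hf0, one_mul, mul_comm e, hfe]
    rw [inf_assoc, inf_idem]
  have hfle : 1 ⊓ e ≤ e := inf_le_right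
  -- With `f = 1 ⊓ e`, the relations `fe = e` and `f² = f` give `(e - f)² = f - e`, so `e ≤ f ≤ 1`.
  have hu : 0 ≤ (e - 1 ⊓ e) * (e - 1 ⊓ e) :=
    mul_nonneg (sub_nonneg.2 hfle) (sub_nonneg.2 hfle)
  have hmul : (e - 1 ⊓ e) * (e - 1 ⊓ e) = 1 ⊓ e - e := by
    linear_combination he' - 2 * hfe + hff
  rw [hmul, sub_nonneg] at hu
  exact hu.trans inf_le_left

theorem IsRegularSemiring.hasPrincipalComplements {R : Type*} [CommRing R] [Lattice R]
    [IsFRing R] (h : IsRegularSemiring (PositiveCone R)) :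
    HasPrincipalComplements (PositiveCone R) := by
  intro a
  obtain ⟨b, hb⟩ := h a
  have hb' : (a : R) = (a : R) ^ 2 * b := by
    have := congrArg Subtype.val hb
    simpa using this
  have he : IsIdempotentElem ((a : R) * b) := by
    change (a : R) * b * (a * b) = a * b
    linear_combination -(b : R) * hb'
  have hle := he.le_one_of_nonneg (mul_nonneg a.2 b.2)
  refine ⟨b, ⟨1 - a * b, sub_nonneg.2 hle⟩, Subtype.ext ?_, Subtype.ext ?_⟩
  · change (a : R) * (1 - a * b) = 0
    linear_combination hb'
  · change (a : R) * b + (1 - a * b) = 1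
    ring

section CommSemiring

variable {S : Type*} [CommSemiring S]

/-- Each prime contains exactly one of `a` and `c`, so every basic open set is clopen. -/
theorem HasPrincipalComplements.isStoneSpace (h : HasPrincipalComplements S) :
    IsStoneSpace (PrimeSpectrum S) := by
  have : TotallySeparatedSpace (PrimeSpectrum S) := by
    rw [totallySeparatedSpace_iff_exists_isClopen]
    intro P Q hPQ
    have hcl : ∀ a : S, IsClopen (PrimeSpectrum.basicOpen a : Set (PrimeSpectrum S)) := by
      intro a
      obtain ⟨b, c, hac, habc⟩ := h a
      refine ⟨⟨?_⟩, PrimeSpectrum.isOpen_basicOpen⟩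
      convert PrimeSpectrum.isOpen_basicOpen (a := c) using 1
      ext x
      simp only [Set.mem_compl_iff, SetLike.mem_coe, PrimeSpectrum.mem_basicOpen, not_not]
      constructor
      · intro ha hc
        exact x.2.ne_top ((Ideal.eq_top_iff_one _).2
          (habc ▸ add_mem (Ideal.mul_mem_right b _ ha) hc))
      · intro hc
        exact (x.2.mem_or_mem (hac ▸ zero_mem _ : a * c ∈ x.asIdeal)).resolve_right hc
    have hne : P.asIdeal ≠ Q.asIdeal := fun hh => hPQ (PrimeSpectrum.ext hh)
    by_cases hle : P.asIdeal ≤ Q.asIdeal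
    · obtain ⟨a, haQ, haP⟩ := SetLike.exists_of_lt (lt_of_le_of_ne hle hne)
      exact ⟨_, hcl a, haP, fun hQ => hQ haQ⟩
    · obtain ⟨a, haP, haQ⟩ := SetLike.not_le_iff_exists.1 hle
      exact ⟨_, (hcl a).compl, fun hP => hP haP, fun hQ => hQ haQ⟩
  exact ⟨inferInstance, inferInstance, inferInstance⟩

theorem IsStoneSpace.isMaximal (h : IsStoneSpace (PrimeSpectrum S)) (P : Ideal S)
    (hP : P.IsPrime) : P.IsMaximal := by
  have := h.2.1
  exact (PrimeSpectrum.isClosed_singleton_iff_isMaximal ⟨P, hP⟩).1 isClosed_singleton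

/-- In a distributive lattice the complemented elements form a sublattice, and `D c` complements the
generator `D a`. -/
theorem HasPrincipalComplements.complementedLattice (h : HasPrincipalComplements S)
    {L : Type*} [DistribLattice L] [BoundedOrder L] {D : S → L} (hD : IsSupport D) :
    ComplementedLattice L := by
  let M : Sublattice L :=
    { carrier := {x | IsComplemented x}
      supClosed' := fun _ hx _ hy => hx.sup hy
      infClosed' := fun _ hx _ hy => hx.inf hy }
  have hM : M = ⊤ := by
    refine hD.generates M fun a => ?_
    obtain ⟨b, c, hac, habc⟩ := h a
    refine ⟨D c, disjoint_iff.2 ?_, codisjoint_iff.2 (top_unique ?_)⟩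
    · rw [← hD.map_mul, hac, hD.map_zero]
    · rw [← hD.map_one, ← habc]
      refine (hD.map_add_le _ _).trans (sup_le_sup_right ?_ _)
      rw [hD.map_mul]
      exact inf_le_left
  exact ⟨fun x => (hM ▸ Sublattice.mem_top x : x ∈ M)⟩

/-- Every element of the lattice of a support is a finite join of basic elements. -/
theorem IsSupport.exists_finset_sup {L : Type*} [DistribLattice L] [BoundedOrder L] {D : S → L}
    (hD : IsSupport D) (x : L) : ∃ t : Finset S, x = t.sup D := by
  classical
  let M : Sublattice L :=
    { carrier := {x | ∃ t : Finset S, x = t.sup D}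
      supClosed' := by
        rintro _ ⟨s, rfl⟩ _ ⟨t, rfl⟩
        exact ⟨s ∪ t, Finset.sup_union.symm⟩
      infClosed' := by
        rintro _ ⟨s, rfl⟩ _ ⟨t, rfl⟩
        refine ⟨(s ×ˢ t).image fun p => p.1 * p.2, ?_⟩
        rw [Finset.sup_inf_sup, Finset.sup_image]
        exact Finset.sup_congr rfl fun p _ => (hD.map_mul _ _).symm }
  have hM : M = ⊤ := hD.generates M fun a => ⟨{a}, by simp⟩
  exact (hM ▸ Sublattice.mem_top x : x ∈ M)

theorem IsSupport.isRegularSemiring [IsReduced S] {L : Type*} [DistribLattice L]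
    [BoundedOrder L] {D : S → L} (hD : IsSupport D) (h : ComplementedLattice L) :
    IsRegularSemiring S := by
  classical
  intro a
  obtain ⟨y, hy⟩ := h.exists_isCompl (D a)
  obtain ⟨t, rfl⟩ := hD.exists_finset_sup y
  have hann : ∀ b ∈ t, a * b = 0 := by
    intro b hb
    -- The empty join makes `a * b` nilpotent, hence zero.
    have hbot : D (a * b) ≤ (∅ : Finset S).sup D := by
      rw [hD.map_mul, Finset.sup_empty, ← hy.inf_eq_bot]
      exact inf_le_inf_left _ (Finset.le_sup hb)
    obtain ⟨n, hn⟩ := hD.mem_radical _ _ hbot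
    have hn0 : (a * b) ^ n = 0 := by simpa using hn
    exact eq_zero_of_pow_eq_zero hn0
  have hone : (1 : S) ∈ Ideal.span ((insert a t : Finset S) : Set S) := by
    obtain ⟨n, hn⟩ := hD.mem_radical 1 (insert a t) (by
      rw [Finset.sup_insert, hy.sup_eq_top]; exact le_top)
    rwa [one_pow] at hn
  rw [Finset.coe_insert, Ideal.mem_span_insert] at hone
  obtain ⟨x, z, hz, hxz⟩ := hone
  have haz : a * z = 0 := by
    clear hxz
    induction hz using Submodule.span_induction with
    | mem w hw => exact hann w hw
    | zero => exact mul_zero a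
    | add u v _ _ hu hv => rw [mul_add, hu, hv, add_zero]
    | smul r u _ hu => rw [smul_eq_mul, mul_left_comm, hu, mul_zero]
  refine ⟨x, ?_⟩
  calc a = a * (x * a + z) := by rw [← hxz, mul_one]
    _ = a ^ 2 * x := by rw [mul_add, haz]; ring

theorem isRegularSemiring_of_isMaximal [IsReduced S]
    (h : ∀ P : Ideal S, P.IsPrime → P.IsMaximal) : IsRegularSemiring S := by
  intro a
  let A : Ideal S :=
    { carrier := {c | a * c = 0}
      add_mem' := fun {u v} hu hv => by
        change a * (u + v) = 0
        rw [mul_add, hu, hv, add_zero]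
      zero_mem' := mul_zero a
      smul_mem' := fun r u hu => by
        change a * (r * u) = 0
        rw [mul_left_comm, hu, mul_zero] }
  have htop : Ideal.span {a} ⊔ A = ⊤ := by
    by_contra hne
    obtain ⟨M, hM, hle⟩ := Ideal.exists_le_maximal _ hne
    have hMp := hM.isPrime
    have haM : a ∈ M := hle (Ideal.mem_sup_left (Ideal.mem_span_singleton_self a))
    -- A prime avoiding `T` lies inside `M` but misses `a ∈ M`, so it is not maximal.
    let T : Submonoid S := M.primeCompl ⊔ Submonoid.powers a
    have hdisj : Disjoint ((⊥ : Ideal S) : Set S) (T : Set S) := by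
      rw [Set.disjoint_left]
      intro x hx hxT
      obtain rfl : x = 0 := hx
      obtain ⟨s, hs, _, ⟨n, rfl⟩, hsn⟩ := Submonoid.mem_sup.1 hxT
      have has : a * s = 0 := by
        refine eq_zero_of_pow_eq_zero (n := n + 1) ?_
        calc (a * s) ^ (n + 1) = (s * a ^ n) * (a * s ^ n) := by ring
          _ = 0 := by rw [hsn, zero_mul]
      exact hs (hle (Ideal.mem_sup_right has))
    obtain ⟨P, hP, -, hPT⟩ := Ideal.exists_le_prime_disjoint _ _ hdisj
    have hPM : P ≤ M := fun x hx => by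
      by_contra hxM
      exact Set.disjoint_left.1 hPT hx (Submonoid.mem_sup_left (show x ∈ M.primeCompl from hxM))
    have hPeq := (h P hP).eq_of_le hM.ne_top hPM
    exact Set.disjoint_left.1 hPT (hPeq ▸ haM)
      (Submonoid.mem_sup_right (Submonoid.mem_powers a))
  obtain ⟨u, hu, c, hc, huc⟩ := Submodule.mem_sup.1 ((Ideal.eq_top_iff_one _).1 htop)
  obtain ⟨x, rfl⟩ := Ideal.mem_span_singleton.1 hu
  refine ⟨x, ?_⟩
  calc a = a * (a * x + c) := by rw [huc, mul_one]
    _ = a ^ 2 * x := by rw [mul_add, (show a * c = 0 from hc)]; ring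

theorem HasPrincipalComplements.isZeroDimensionalFrame (h : HasPrincipalComplements S) :
    IsZeroDimensionalFrame (RId S) := by
  intro I
  refine ⟨{J | IsComplemented J ∧ J ≤ I}, fun J hJ => hJ.1,
    le_antisymm (fun a ha => ?_) (sSup_le fun J hJ => hJ.2)⟩
  have hcompl : IsComplemented (RId.ofIdeal (Ideal.span {a})) := by
    obtain ⟨b, c, hac, habc⟩ := h a
    refine ⟨RId.ofIdeal (Ideal.span {c}), disjoint_iff_inf_le.2 ?_, codisjoint_iff_le_sup.2 ?_⟩
    · rintro x ⟨⟨n, hn⟩, ⟨m, hm⟩⟩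
      obtain ⟨y, hy⟩ := Ideal.mem_span_singleton.1 hn
      obtain ⟨z, hz⟩ := Ideal.mem_span_singleton.1 hm
      refine (⊥ : RId S).2 ⟨n + m, ?_⟩
      have hx : x ^ (n + m) = 0 := by
        calc x ^ (n + m) = (a * c) * (y * z) := by rw [pow_add, hy, hz]; ring
          _ = 0 := by rw [hac, zero_mul]
      rw [hx]
      exact zero_mem _
    · intro x _
      have h1 : (1 : S) ∈
          (RId.ofIdeal (Ideal.span {a}) ⊔ RId.ofIdeal (Ideal.span {c})).1 := by
        rw [RId.coe_sup, ← habc]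
        refine Ideal.le_radical (add_mem (Ideal.mem_sup_left (Ideal.mul_mem_right _ _ ?_))
          (Ideal.mem_sup_right ?_)) <;>
        exact Ideal.le_radical (Ideal.mem_span_singleton_self _)
      exact ((Ideal.eq_top_iff_one _).2 h1).ge trivial
  have hle : RId.ofIdeal (Ideal.span {a}) ≤ I :=
    RId.gi.gc.l_le ((Ideal.span_singleton_le_iff_mem _).2 ha)
  exact (le_sSup (show _ ∈ {J | IsComplemented J ∧ J ≤ I} from ⟨hcompl, hle⟩) :
    RId.ofIdeal (Ideal.span {a}) ≤ _) (Ideal.le_radical (Ideal.mem_span_singleton_self a))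

/-- For `a ∈ J \ P`, some complemented `c` below the radical of `(a)` is not below `P`. Primality
puts its complement below `P`, so `J` contains 1. -/
theorem IsZeroDimensionalFrame.isMaximal (h : IsZeroDimensionalFrame (RId S)) (P : Ideal S)
    (hP : P.IsPrime) : P.IsMaximal := by
  refine ⟨⟨hP.ne_top, fun J hPJ => ?_⟩⟩
  obtain ⟨a, haJ, haP⟩ := SetLike.exists_of_lt hPJ
  obtain ⟨C, hC, haC⟩ := h (RId.ofIdeal (Ideal.span {a}))
  let P' : RId S := ⟨P, hP.isRadical⟩
  obtain ⟨c, hcC, hcP⟩ : ∃ c ∈ C, ¬ c ≤ P' := by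
    by_contra! hall
    have hle : RId.ofIdeal (Ideal.span {a}) ≤ P' := haC ▸ sSup_le hall
    exact haP (hle (Ideal.le_radical (Ideal.mem_span_singleton_self a)))
  obtain ⟨d, hcd⟩ := hC c hcC
  have hcJ : c ≤ RId.ofIdeal J := by
    refine (haC ▸ le_sSup hcC : c ≤ RId.ofIdeal (Ideal.span {a})).trans ?_
    exact RId.gi.gc.monotone_l ((Ideal.span_singleton_le_iff_mem _).2 haJ)
  have hdP : d ≤ P' := by
    have hinf : c.1 ⊓ d.1 ≤ P := (hcd.inf_eq_bot.trans_le bot_le : c ⊓ d ≤ P')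
    exact (hP.inf_le.1 hinf).resolve_left hcP
  have hdJ : d ≤ RId.ofIdeal J := hdP.trans (hPJ.le.trans Ideal.le_radical : P ≤ J.radical)
  have htop : (⊤ : RId S) ≤ RId.ofIdeal J := hcd.sup_eq_top ▸ sup_le hcJ hdJ
  have hone : RId.ofIdeal (⊤ : Ideal S) ≤ RId.ofIdeal J := le_top.trans htop
  exact Ideal.radical_eq_top.1 (top_unique (Ideal.le_radical.trans hone))

end CommSemiring

theorem theorem4 {R : Type*} [CommRing R] [Lattice R] [IsFRing R] [IsReduced (PositiveCone R)]
    {L : Type*} [DistribLattice L] [BoundedOrder L] (D : PositiveCone R → L)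
    (hD : IsSupport D) :
    List.TFAE [
      IsStoneSpace (PrimeSpectrum (PositiveCone R)),
      ComplementedLattice L,
      IsRegularSemiring (PositiveCone R),
      IsZeroDimensionalFrame (RId (PositiveCone R)),
      ∀ P : Ideal (PositiveCone R), P.IsPrime → P.IsMaximal] := by
  tfae_have 1 → 5 := fun h => h.isMaximal
  tfae_have 3 → 1 := fun h => h.hasPrincipalComplements.isStoneSpace
  tfae_have 3 → 2 := fun h => h.hasPrincipalComplements.complementedLattice hD
  tfae_have 2 → 3 := fun h => hD.isRegularSemiring h
  tfae_have 3 → 4 := fun h => h.hasPrincipalComplements.isZeroDimensionalFrame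
  tfae_have 4 → 5 := fun h => h.isMaximal
  tfae_have 5 → 3 := isRegularSemiring_of_isMaximal
  tfae_finish
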